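/- Let $m,n\ge 1$ be integers and let $R=[0,m]\times[0,n]$. For $(i,j)\in\mathbb Z^2\cap R$ with $i+j$ odd there are oriented edges from $(i,j)$ to $(i+1,j+1)$ and from $(i,j)$ to $(i+1,j-1)$, whenever the arrow endvertex lies in $R$. Each of these oriented edges is declared open or closed in an arbitrary way. An oriented path is a nonempty finite sequence of distinct oriented edges such that the arrow endvertex of each edge is the non-arrow endvertex of the next one. Let $\mathcal C\subset\mathbb Z^2\cap R$ be the open oriented cluster of the left edge: $(0,j)\in\mathcal C$ if and only if $j$ is odd, and a vertex $x$ of $R$ with first coordinate at least $1$ belongs to $\mathcal C$ if and only if there is an oriented path of open edges that starts at some $(0,j)\in\mathcal C$ and ends at $x$. For $z\in\mathbb Z^2$ let $S_z$ be the closed square with corners $z\pm(1,0)$ and $z\pm(0,1)$. Let $G_0$ be the graph whose vertices and edges are the corners and the edges of the squares $S_z$, $z\in\mathcal C$. For a cycle $C$ of $G_0$ (not intersecting itself), an edge $e$ is said to belong to the exterior of $C$ if both squares $S_z$ having $e$ as an edge lie in the exterior of $C$, that is, their interiors are contained in the unbounded component of $\mathbb R^2\setminus C$. The outermost boundary $\partial_0$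 of the star-connected union $\bigcup_{z\in\mathcal C}S_z$ is the set of all edges $e$ of $G_0$ such that, for every cycle $C$ of $G_0$, either $e$ is an edge of $C$ or $e$ belongs to the exterior of $C$. For each $z\in\mathcal C$, orient the four edges of $S_z$ clockwise. Then every cycle of $G_0$ all of whose edges belong to $\partial_0$ is an oriented dual cycle: each of its edges receives exactly one orientation in this way, and with these orientations its edges, taken in the order of one of the two directions of traversal of the cycle, form an oriented path with coincident endvertices. -/

import Mathlib

namespace OrientedPercolation

/-- Lattice points of the plane. -/
abbrev Pt : Type := ℤ × ℤ

/-- The lattice points of the rectangle `[0,m] × [0,n]`. -/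
def rect (m n : ℕ) : Set Pt :=
  {x | 0 ≤ x.1 ∧ x.1 ≤ m ∧ 0 ≤ x.2 ∧ x.2 ≤ n}

/-- The oriented edges of the percolation model. A pair `(x, y)` is the edge with non arrow
endvertex `x` and arrow endvertex `y`. There are edges from `(i,j)` to `(i+1,j+1)` and to
`(i+1,j-1)` whenever `i + j` is odd and both endvertices lie in the rectangle. -/
def modelEdges (m n : ℕ) : Set (Pt × Pt) :=
  {e | e.1 ∈ rect m n ∧ e.2 ∈ rect m n ∧ Odd (e.1.1 + e.1.2) ∧ e.2.1 = e.1.1 + 1 ∧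
    (e.2.2 = e.1.2 + 1 ∨ e.2.2 = e.1.2 - 1)}

/-- `L` is an oriented path from `x` to `y` using oriented edges of `E`: a nonempty sequence of
distinct oriented edges in which the arrow endvertex of every edge is the non arrow endvertex
of the next one. -/
structure IsOrientedPath (E : Set (Pt × Pt)) (L : List (Pt × Pt)) (x y : Pt) : Prop where
  mem : ∀ e ∈ L, e ∈ E
  nodup : L.Nodup
  consistent : L.IsChain (fun e f => e.2 = f.1)
  start : ∃ e ∈ L.head?, e.1 = x
  finish : ∃ e ∈ L.getLast?, e.2 = y

/-- The open oriented cluster of the left edge, where `ω` is the set of open edges. -/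
def openCluster (m n : ℕ) (ω : Set (Pt × Pt)) : Set Pt :=
  {x | x ∈ rect m n ∧
    ((x.1 = 0 ∧ Odd x.2) ∨
     (x.1 ≠ 0 ∧ ∃ (j : ℤ) (L : List (Pt × Pt)),
        ((0, j) : Pt) ∈ rect m n ∧ Odd j ∧ IsOrientedPath ω L (0, j) x))}

/-- The four edges of the square `S_z` with corners `z ± (1,0)` and `z ± (0,1)`, oriented
clockwise: in this order `↗`, `↘`, `↙`, `↖`. -/
def arrows (z : Pt) : Set (Pt × Pt) :=
  {((z.1 - 1, z.2), (z.1, z.2 + 1)), ((z.1, z.2 + 1), (z.1 + 1, z.2)),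
   ((z.1 + 1, z.2), (z.1, z.2 - 1)), ((z.1, z.2 - 1), (z.1 - 1, z.2))}

/-- The four unoriented edges of the square `S_z`. -/
def squareEdges (z : Pt) : Set (Sym2 Pt) :=
  (fun a : Pt × Pt => s(a.1, a.2)) '' arrows z

/-- The interior of the square `S_z` as a subset of the plane. -/
def openSquare (z : Pt) : Set (ℝ × ℝ) :=
  {p | |p.1 - z.1| + |p.2 - z.2| < 1}

/-- The graph formed by the corners and the edges of the squares `S_z`, `z ∈ K`. -/
def squareGraph (K : Set Pt) : SimpleGraph Pt :=
  SimpleGraph.fromEdgeSet (⋃ z ∈ K, squareEdges z)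

/-- A lattice point as a point of the plane. -/
def toPlane (a : Pt) : ℝ × ℝ := ((a.1 : ℝ), (a.2 : ℝ))

/-- The subset of the plane covered by the edges of a walk. -/
def trace {G : SimpleGraph Pt} {u v : Pt} (p : G.Walk u v) : Set (ℝ × ℝ) :=
  ⋃ d ∈ p.darts, segment ℝ (toPlane d.fst) (toPlane d.snd)

/-- The exterior of a cycle: the unbounded region of the complement of the curve. -/
def cycleExterior {G : SimpleGraph Pt} {v : Pt} (p : G.Walk v v) : Set (ℝ × ℝ) :=
  {x | x ∉ trace p ∧ ¬ Bornology.IsBounded (connectedComponentIn (trace p)ᶜ x)}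

/-- An edge belongs to the exterior of a cycle if every square having it as an edge (there are
two of them) lies in the exterior of the cycle. -/
def EdgeInExterior {G : SimpleGraph Pt} {v : Pt} (e : Sym2 Pt) (p : G.Walk v v) : Prop :=
  ∀ z : Pt, e ∈ squareEdges z → openSquare z ⊆ cycleExterior p

/-- The outermost boundary of the union of the squares `S_z`, `z ∈ K`: the edges which, for
every cycle of the graph of these squares, lie on the cycle or belong to its exterior. -/
def outermostBoundary (K : Set Pt) : Set (Sym2 Pt) :=
  {e | e ∈ (squareGraph K).edgeSet ∧
    ∀ (v : Pt) (p : (squareGraph K).Walk v v), p.IsCycle → e ∈ p.edges ∨ EdgeInExterior e p}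

/-- The oriented dual edges: the edges which receive one and only one orientation when the
edges of every square `S_z` with `z ∈ K` are oriented clockwise, with that orientation. -/
def orientedDualEdges (K : Set Pt) : Set (Pt × Pt) :=
  {a | (∃ z ∈ K, a ∈ arrows z) ∧ ∀ z ∈ K, a.swap ∉ arrows z}

/-- A closed walk, traversed in one of its two directions, is an oriented path of oriented dual
edges with coincident endvertices. -/
def IsOrientedDualCycle (K : Set Pt) {v : Pt} (p : (squareGraph K).Walk v v) : Prop :=
  ∃ q : (squareGraph K).Walk v v, (q = p ∨ q = p.reverse) ∧
    IsOrientedPath (orientedDualEdges K) (q.darts.map (fun d => d.toProd)) v v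

end OrientedPercolation

namespace OrientedPercolation

open SimpleGraph

/-- Two lattice points with even coordinate sum that are joined by a diagonal step. -/
def IsDiagonalStep (a b : Pt) : Prop :=
  (b.1 = a.1 + 1 ∨ b.1 = a.1 - 1) ∧ (b.2 = a.2 + 1 ∨ b.2 = a.2 - 1) ∧ (a.1 + a.2) % 2 = 0

/-- Whether the ray from `z` in direction `(1,1)` crosses the diagonal step from `a` to `b`. -/
def crossing (z a b : Pt) : ZMod 2 :=
  if a.1 + a.2 = b.1 + b.2 ∧ z.1 + z.2 < a.1 + a.2 ∧
    a.1 - a.2 + (b.1 - b.2) = 2 * (z.1 - z.2) then 1 else 0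

lemma crossing_comm (z a b : Pt) : crossing z a b = crossing z b a := by
  unfold crossing
  congr 1
  apply propext
  constructor <;> rintro ⟨h₁, h₂, h₃⟩ <;> refine ⟨?_, ?_, ?_⟩ <;> omega

/-- The number modulo two of crossings of a walk with the ray from `z` in direction `(1,1)`. -/
def wind {G : SimpleGraph Pt} (z : Pt) {u v : Pt} (p : G.Walk u v) : ZMod 2 :=
  (p.darts.map fun d => crossing z d.fst d.snd).sum

section wind

variable {G : SimpleGraph Pt} {z z' u v w : Pt}

@[simp] lemma wind_nil : wind z (Walk.nil : G.Walk u u) = 0 := by simp [wind]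

@[simp] lemma wind_cons (h : G.Adj u v) (p : G.Walk v w) :
    wind z (Walk.cons h p) = crossing z u v + wind z p := by simp [wind]

@[simp] lemma wind_append (p : G.Walk u v) (q : G.Walk v w) :
    wind z (p.append q) = wind z p + wind z q := by simp [wind]

@[simp] lemma wind_reverse (p : G.Walk u v) : wind z p.reverse = wind z p := by
  simp only [wind, Walk.darts_reverse, List.map_reverse, List.sum_reverse, List.map_map]
  congr 1
  apply List.map_congr_left
  intro d _
  exact crossing_comm _ _ _

lemma add_self_zmod_two (x : ZMod 2) : x + x = 0 := CharTwo.add_self_eq_zero x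

lemma eq_one_of_ne_zero_zmod_two {x : ZMod 2} (h : x ≠ 0) : x = 1 := by
  revert x; decide

lemma eq_single_of_isPath {p : G.Walk w u} (hp : p.IsPath) (he : s(u, w) ∈ p.edges) :
    ∃ h : G.Adj w u, p = Walk.cons h Walk.nil := by
  cases p with
  | nil => simp at he
  | @cons _ x _ h r =>
    rw [Walk.cons_isPath_iff] at hp
    rw [Walk.edges_cons, List.mem_cons] at he
    rcases he with he | he
    · obtain rfl : x = u := by
        rw [Sym2.eq_iff] at he
        rcases he with ⟨h₁, h₂⟩ | ⟨h₁, -⟩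
        · exact absurd h₂ (by rintro rfl; subst h₁; exact G.loopless.irrefl _ h)
        · exact h₁.symm
      exact ⟨h, by rw [(Walk.isPath_iff_nil.1 hp.1).eq_nil]⟩
    · exact absurd (Walk.snd_mem_support_of_mem_edges _ he) hp.2

lemma exists_isCycle_or_wind_bypass (p : G.Walk u v) :
    (∃ (x : Pt) (q : G.Walk x x), q.IsCycle ∧ q.edges ⊆ p.edges ∧ wind z q ≠ 0) ∨
      wind z p = wind z p.bypass := by
  induction p with
  | nil => right; rfl
  | @cons u w v h p ih =>
    rcases ih with ⟨x, q, hq, hs, hw⟩ | ih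
    · exact Or.inl ⟨x, q, hq, fun e he => by simp [hs he], hw⟩
    by_cases hu : u ∈ p.bypass.support
    · have hb : (Walk.cons h p).bypass = p.bypass.dropUntil u hu := by simp [Walk.bypass, hu]
      have hsum : wind z p = wind z (p.bypass.takeUntil u hu) +
          wind z (p.bypass.dropUntil u hu) := by
        rw [ih, ← wind_append, Walk.take_spec]
      have htake : (p.bypass.takeUntil u hu).IsPath := p.bypass_isPath.takeUntil hu
      by_cases he : s(u, w) ∈ (p.bypass.takeUntil u hu).edges
      · obtain ⟨h', hp⟩ := eq_single_of_isPath htake he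
        right
        rw [hb, wind_cons, hsum, hp, wind_cons, wind_nil, crossing_comm z w u, add_zero,
          ← add_assoc, add_self_zmod_two, zero_add]
      · have hcyc : (Walk.cons h (p.bypass.takeUntil u hu)).IsCycle :=
          (Walk.cons_isCycle_iff _ h).2 ⟨htake, he⟩
        by_cases hw : wind z (Walk.cons h (p.bypass.takeUntil u hu)) = 0
        · right
          rw [hb, wind_cons, hsum, ← add_assoc, ← wind_cons h, hw, zero_add]
        · refine Or.inl ⟨u, _, hcyc, ?_, hw⟩
          rw [Walk.edges_cons, Walk.edges_cons]
          exact List.cons_subset_cons _ fun e he =>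
            p.edges_bypass_subset_edges (Walk.edges_takeUntil_subset_edges _ hu he)
    · right
      simp [Walk.bypass, hu, ih]

lemma exists_isCycle_of_wind_ne_zero (p : G.Walk v v) (hp : wind z p ≠ 0) :
    ∃ (x : Pt) (q : G.Walk x x), q.IsCycle ∧ q.edges ⊆ p.edges ∧ wind z q ≠ 0 := by
  refine (exists_isCycle_or_wind_bypass p).resolve_right fun h => hp ?_
  rw [h, (Walk.isPath_iff_nil.1 p.bypass_isPath).eq_nil, wind_nil]

/-- The indicator of the ray from the right corner of `S_z` in direction `(1,1)`. -/
def cornerRay (z a : Pt) : ZMod 2 :=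
  if a.1 - a.2 = z.1 - z.2 + 1 ∧ z.1 + z.2 < a.1 + a.2 then 1 else 0

lemma crossing_add_crossing_right (hz : (z.1 + z.2) % 2 = 1) (h : IsDiagonalStep u v) :
    crossing z u v + crossing (z.1 + 1, z.2 - 1) u v +
      (if s(u, v) = s((z.1 + 1, z.2), (z.1, z.2 - 1)) then 1 else 0) =
      cornerRay z u + cornerRay z v := by
  obtain ⟨a, b⟩ := u
  obtain ⟨c, d⟩ := v
  obtain ⟨x, y⟩ := z
  obtain ⟨h₁, h₂, h₃⟩ := h
  simp only [crossing, cornerRay, Sym2.eq_iff, Prod.mk.injEq] at *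
  rcases h₁ with rfl | rfl <;> rcases h₂ with rfl | rfl <;> split_ifs <;>
    first | rfl | (exfalso; omega)

lemma crossing_add_crossing_up (hz : (z.1 + z.2) % 2 = 1) (h : IsDiagonalStep u v) :
    crossing z u v + crossing (z.1 + 1, z.2 + 1) u v =
      (if s(u, v) = s((z.1, z.2 + 1), (z.1 + 1, z.2)) then 1 else 0) := by
  obtain ⟨a, b⟩ := u
  obtain ⟨c, d⟩ := v
  obtain ⟨x, y⟩ := z
  obtain ⟨h₁, h₂, h₃⟩ := h
  simp only [crossing, Sym2.eq_iff, Prod.mk.injEq] at *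
  rcases h₁ with rfl | rfl <;> rcases h₂ with rfl | rfl <;> split_ifs <;>
    first | rfl | (exfalso; omega)

lemma wind_add_wind_right_of_walk (hG : ∀ a b, G.Adj a b → IsDiagonalStep a b)
    (hz : (z.1 + z.2) % 2 = 1) (p : G.Walk u v) :
    wind z p + wind (z.1 + 1, z.2 - 1) p +
      (p.edges.count s((z.1 + 1, z.2), (z.1, z.2 - 1)) : ZMod 2) =
      cornerRay z u + cornerRay z v := by
  induction p with
  | nil => simp [add_self_zmod_two]
  | @cons u w v h p ih =>
    have h₁ := crossing_add_crossing_right hz (hG _ _ h)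
    have h₂ := add_self_zmod_two (cornerRay z w)
    rw [wind_cons, wind_cons, Walk.edges_cons, List.count_cons]
    simp only [beq_iff_eq]
    push_cast
    linear_combination h₁ + ih + h₂

lemma wind_add_wind_up (hG : ∀ a b, G.Adj a b → IsDiagonalStep a b)
    (hz : (z.1 + z.2) % 2 = 1) (p : G.Walk u v) :
    wind z p + wind (z.1 + 1, z.2 + 1) p =
      (p.edges.count s((z.1, z.2 + 1), (z.1 + 1, z.2)) : ZMod 2) := by
  induction p with
  | nil => simp
  | @cons u w v h p ih =>
    have h₁ := crossing_add_crossing_up hz (hG _ _ h)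
    rw [wind_cons, wind_cons, Walk.edges_cons, List.count_cons]
    simp only [beq_iff_eq]
    push_cast
    linear_combination h₁ + ih

lemma wind_add_wind_right (hG : ∀ a b, G.Adj a b → IsDiagonalStep a b)
    (hz : (z.1 + z.2) % 2 = 1) (p : G.Walk v v) :
    wind z p + wind (z.1 + 1, z.2 - 1) p =
      (p.edges.count s((z.1 + 1, z.2), (z.1, z.2 - 1)) : ZMod 2) := by
  have h := wind_add_wind_right_of_walk hG hz p
  rw [add_self_zmod_two] at h
  exact CharTwo.add_eq_zero.1 h

/-- The parity of a closed walk changes across an edge exactly when the walk uses the edge an odd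
number of times. -/
lemma wind_add_wind_of_arrows (hG : ∀ a b, G.Adj a b → IsDiagonalStep a b)
    (hz : (z.1 + z.2) % 2 = 1) {a b : Pt} (h : (a, b) ∈ arrows z) (h' : (b, a) ∈ arrows z')
    (p : G.Walk v v) :
    wind z p + wind z' p = (p.edges.count s(a, b) : ZMod 2) := by
  obtain ⟨x, y⟩ := z
  obtain ⟨x', y'⟩ := z'
  obtain ⟨a₁, a₂⟩ := a
  obtain ⟨b₁, b₂⟩ := b
  simp only [arrows, Set.mem_insert_iff, Set.mem_singleton_iff, Prod.mk.injEq] at h h' hz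
  have hz' : (x' + y') % 2 = 1 := by omega
  rcases h with h | h | h | h
  · obtain ⟨rfl, rfl⟩ : x = x' + 1 ∧ y = y' - 1 := by omega
    obtain ⟨⟨rfl, rfl⟩, rfl, rfl⟩ := h
    have := wind_add_wind_right (z := (_, _)) hG hz' p
    rw [add_comm, this, Sym2.eq_swap]
    congr 3 <;> ext <;> simp
  · obtain ⟨rfl, rfl⟩ : x' = x + 1 ∧ y' = y + 1 := by omega
    obtain ⟨⟨rfl, rfl⟩, rfl, rfl⟩ := h
    exact wind_add_wind_up (z := (_, _)) hG hz p
  · obtain ⟨rfl, rfl⟩ : x' = x + 1 ∧ y' = y - 1 := by omega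
    obtain ⟨⟨rfl, rfl⟩, rfl, rfl⟩ := h
    exact wind_add_wind_right (z := (_, _)) hG hz p
  · obtain ⟨rfl, rfl⟩ : x = x' + 1 ∧ y = y' + 1 := by omega
    obtain ⟨⟨rfl, rfl⟩, rfl, rfl⟩ := h
    have := wind_add_wind_up (z := (_, _)) hG hz' p
    rw [add_comm, this, Sym2.eq_swap]
    congr 3 <;> ext <;> simp

lemma exists_bound_support (p : G.Walk u v) :
    ∃ N : ℤ, ∀ a ∈ p.support, |a.1| + |a.2| ≤ N := by
  obtain ⟨N, hN⟩ := (p.support.toFinset.image fun a => |a.1| + |a.2|).bddAbove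
  exact ⟨N, fun a ha => hN (by simpa using ⟨a.1, a.2, ha, rfl⟩)⟩

lemma wind_eq_zero_of_crossing (p : G.Walk u v)
    (h : ∀ d ∈ p.darts, crossing z d.fst d.snd = 0) : wind z p = 0 := by
  unfold wind
  apply List.sum_eq_zero
  simpa using h

/-- A closed walk has only finitely many points around which it winds. -/
lemma exists_bound_wind (hG : ∀ a b, G.Adj a b → IsDiagonalStep a b) (p : G.Walk v v) :
    ∃ N : ℤ, ∀ z : Pt, (z.1 + z.2) % 2 = 1 → wind z p ≠ 0 →
      |z.1 + z.2| ≤ N ∧ |z.1 - z.2| ≤ N := by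
  obtain ⟨N, hN⟩ := exists_bound_support p
  have hN' : ∀ a ∈ p.support, a.1 + a.2 ≤ N ∧ -N ≤ a.1 + a.2 ∧ a.1 - a.2 ≤ N ∧
      -N ≤ a.1 - a.2 := by
    intro a ha
    have h₁ := hN a ha
    have := abs_le.1 (le_refl |a.1|)
    have := abs_le.1 (le_refl |a.2|)
    omega
  have hbound : ∀ z : Pt, wind z p ≠ 0 →
      z.1 + z.2 ≤ N ∧ z.1 - z.2 ≤ N ∧ -N ≤ z.1 - z.2 := by
    intro z hz
    by_contra hcon
    refine hz (wind_eq_zero_of_crossing p fun d hd => if_neg ?_)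
    have h₁ := hN' _ (Walk.dart_fst_mem_support_of_mem_darts p hd)
    have h₂ := hN' _ (Walk.dart_snd_mem_support_of_mem_darts p hd)
    omega
  have hlow : ∀ (k : ℕ) (z : Pt), (z.1 + z.2) % 2 = 1 → z.1 + z.2 < -N - 1 →
      N < z.1 - z.2 + k → wind z p = 0 := by
    intro k
    induction k with
    | zero =>
      intro z _ _ hk
      by_contra hz
      have := hbound z hz
      simp at hk
      omega
    | succ k ih =>
      intro z hz hs hk
      have h₁ := ih (z.1 + 1, z.2 - 1) (by simp only; omega) (by simp only; omega)
        (by push_cast at hk; simp only; omega)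
      have h₂ := wind_add_wind_right hG hz p
      rw [h₁, List.count_eq_zero.2] at h₂
      · simpa using h₂
      · intro hmem
        have := hN' _ (Walk.fst_mem_support_of_mem_edges p hmem)
        simp only at this
        omega
  refine ⟨N + 1, fun z hz hw => ?_⟩
  have h₁ := hbound z hw
  have h₂ : -N - 1 ≤ z.1 + z.2 := by
    by_contra hcon
    exact hw (hlow (N - (z.1 - z.2) + 1).toNat z hz (by omega) (by omega))
  constructor <;> rw [abs_le] <;> omega

end wind

/-- The closed square `S_z` as a subset of the plane. -/
def closedSquare (z : Pt) : Set (ℝ × ℝ) :=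
  {x | |x.1 + x.2 - (z.1 + z.2)| ≤ 1 ∧ |x.1 - x.2 - (z.1 - z.2)| ≤ 1}

lemma isClosed_closedSquare (z : Pt) : IsClosed (closedSquare z) :=
  IsClosed.and (isClosed_le (by fun_prop) (by fun_prop)) (isClosed_le (by fun_prop) (by fun_prop))

lemma toPlane_mem_closedSquare (z : Pt) : toPlane z ∈ closedSquare z := by
  simp [closedSquare, toPlane]

lemma locallyFinite_closedSquare : LocallyFinite closedSquare := by
  intro x
  refine ⟨Metric.ball x 1, Metric.ball_mem_nhds x one_pos, ?_⟩
  refine (Set.finite_Icc ((⌊x.1⌋ - 3, ⌊x.2⌋ - 3) : Pt) (⌊x.1⌋ + 4, ⌊x.2⌋ + 4)).subset ?_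
  rintro z ⟨y, ⟨h₁, h₂⟩, hy⟩
  rw [Metric.mem_ball, Prod.dist_eq, max_lt_iff, Real.dist_eq, Real.dist_eq, abs_lt, abs_lt] at hy
  rw [abs_le] at h₁ h₂
  obtain ⟨⟨_, _⟩, _, _⟩ := hy
  have := Int.floor_le x.1
  have := Int.lt_floor_add_one x.1
  have := Int.floor_le x.2
  have := Int.lt_floor_add_one x.2
  simp only [Set.mem_Icc, Prod.le_def]
  refine ⟨⟨?_, ?_⟩, ?_, ?_⟩ <;> rify <;> linarith [h₁.1, h₁.2, h₂.1, h₂.2]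

lemma isClosed_biUnion_closedSquare (A : Set Pt) : IsClosed (⋃ z ∈ A, closedSquare z) := by
  rw [Set.biUnion_eq_iUnion]
  exact (locallyFinite_closedSquare.comp_injective Subtype.val_injective).isClosed_iUnion
    fun z => isClosed_closedSquare z

lemma exists_mem_closedSquare (x : ℝ × ℝ) :
    ∃ z : Pt, (z.1 + z.2) % 2 = 1 ∧ x ∈ closedSquare z := by
  refine ⟨(⌊(x.1 + x.2) / 2⌋ + ⌊(x.1 - x.2) / 2⌋ + 1, ⌊(x.1 + x.2) / 2⌋ - ⌊(x.1 - x.2) / 2⌋),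
    by simp only; omega, ?_⟩
  have := Int.floor_le ((x.1 + x.2) / 2)
  have := Int.lt_floor_add_one ((x.1 + x.2) / 2)
  have := Int.floor_le ((x.1 - x.2) / 2)
  have := Int.lt_floor_add_one ((x.1 - x.2) / 2)
  simp only [closedSquare, Set.mem_ofPred_eq, abs_le]
  push_cast
  refine ⟨⟨?_, ?_⟩, ?_, ?_⟩ <;> linarith

section exterior

variable {G : SimpleGraph Pt} {z z' v : Pt}

lemma segment_subset_trace {u w a b : Pt} {p : G.Walk u w} (h : s(a, b) ∈ p.edges) :
    segment ℝ (toPlane a) (toPlane b) ⊆ trace p := by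
  obtain ⟨d, hd, he⟩ := List.mem_map.1 h
  intro x hx
  refine Set.mem_biUnion hd ?_
  rcases SimpleGraph.dart_edge_eq_mk'_iff'.1 he with ⟨h₁, h₂⟩ | ⟨h₁, h₂⟩
  · rwa [h₁, h₂]
  · rwa [h₁, h₂, segment_symm]

lemma mem_trace_of_up (hG : ∀ a b, G.Adj a b → IsDiagonalStep a b) (hz : (z.1 + z.2) % 2 = 1)
    (p : G.Walk v v) (hw : wind z p ≠ wind (z.1 + 1, z.2 + 1) p) {x : ℝ × ℝ}
    (hx : x ∈ closedSquare z) (hx' : x ∈ closedSquare (z.1 + 1, z.2 + 1)) : x ∈ trace p := by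
  have hmem : s((z.1, z.2 + 1), (z.1 + 1, z.2)) ∈ p.edges := by
    by_contra hcon
    have h := wind_add_wind_up hG hz p
    rw [List.count_eq_zero.2 hcon, Nat.cast_zero, CharTwo.add_eq_zero] at h
    exact hw h
  refine segment_subset_trace hmem ?_
  simp only [closedSquare, Set.mem_ofPred_eq, abs_le] at hx hx'
  push_cast at hx'
  refine ⟨(1 - (x.1 - x.2 - (z.1 - z.2))) / 2, (1 + (x.1 - x.2 - (z.1 - z.2))) / 2,
    by linarith, by linarith, by ring, ?_⟩
  ext <;> simp [toPlane] <;> linarith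

lemma mem_trace_of_right (hG : ∀ a b, G.Adj a b → IsDiagonalStep a b) (hz : (z.1 + z.2) % 2 = 1)
    (p : G.Walk v v) (hw : wind z p ≠ wind (z.1 + 1, z.2 - 1) p) {x : ℝ × ℝ}
    (hx : x ∈ closedSquare z) (hx' : x ∈ closedSquare (z.1 + 1, z.2 - 1)) : x ∈ trace p := by
  have hmem : s((z.1 + 1, z.2), (z.1, z.2 - 1)) ∈ p.edges := by
    by_contra hcon
    have h := wind_add_wind_right hG hz p
    rw [List.count_eq_zero.2 hcon, Nat.cast_zero, CharTwo.add_eq_zero] at h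
    exact hw h
  refine segment_subset_trace hmem ?_
  simp only [closedSquare, Set.mem_ofPred_eq, abs_le] at hx hx'
  push_cast at hx'
  refine ⟨(1 + (x.1 + x.2 - (z.1 + z.2))) / 2, (1 - (x.1 + x.2 - (z.1 + z.2))) / 2,
    by linarith, by linarith, by ring, ?_⟩
  ext <;> simp [toPlane] <;> linarith

lemma mem_trace_of_same_diff (hG : ∀ a b, G.Adj a b → IsDiagonalStep a b)
    (hz : (z.1 + z.2) % 2 = 1) (p : G.Walk v v) (hw : wind z p ≠ wind z' p)
    (hd : z.1 - z.2 = z'.1 - z'.2) {x : ℝ × ℝ}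
    (hx : x ∈ closedSquare z) (hx' : x ∈ closedSquare z') : x ∈ trace p := by
  have h₁ := abs_le.1 hx.1
  have h₂ := abs_le.1 hx'.1
  have h₃ : z.1 + z.2 ≤ z'.1 + z'.2 + 2 := by rify; linarith
  have h₄ : z'.1 + z'.2 ≤ z.1 + z.2 + 2 := by rify; linarith
  obtain rfl | rfl | rfl : z' = z ∨ z' = (z.1 + 1, z.2 + 1) ∨ z = (z'.1 + 1, z'.2 + 1) := by
    simp only [Prod.ext_iff]; omega
  · exact absurd rfl hw
  · exact mem_trace_of_up hG hz p hw hx hx'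
  · exact mem_trace_of_up hG (by simp only at hz; omega) p hw.symm hx' hx

lemma mem_trace_of_same_sum (hG : ∀ a b, G.Adj a b → IsDiagonalStep a b)
    (hz : (z.1 + z.2) % 2 = 1) (p : G.Walk v v) (hw : wind z p ≠ wind z' p)
    (hd : z.1 + z.2 = z'.1 + z'.2) {x : ℝ × ℝ}
    (hx : x ∈ closedSquare z) (hx' : x ∈ closedSquare z') : x ∈ trace p := by
  have h₁ := abs_le.1 hx.2
  have h₂ := abs_le.1 hx'.2
  have h₃ : z.1 - z.2 ≤ z'.1 - z'.2 + 2 := by rify; linarith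
  have h₄ : z'.1 - z'.2 ≤ z.1 - z.2 + 2 := by rify; linarith
  obtain rfl | rfl | rfl : z' = z ∨ z' = (z.1 + 1, z.2 - 1) ∨ z = (z'.1 + 1, z'.2 - 1) := by
    simp only [Prod.ext_iff]; omega
  · exact absurd rfl hw
  · exact mem_trace_of_right hG hz p hw hx hx'
  · exact mem_trace_of_right hG (by simp only at hz; omega) p hw.symm hx' hx

lemma mem_trace_of_wind_ne (hG : ∀ a b, G.Adj a b → IsDiagonalStep a b)
    (hz : (z.1 + z.2) % 2 = 1) (hz' : (z'.1 + z'.2) % 2 = 1) (p : G.Walk v v)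
    (hw : wind z p ≠ wind z' p) {x : ℝ × ℝ}
    (hx : x ∈ closedSquare z) (hx' : x ∈ closedSquare z') : x ∈ trace p := by
  obtain ⟨y, hs, hd⟩ : ∃ y : Pt, y.1 + y.2 = z.1 + z.2 ∧ y.1 - y.2 = z'.1 - z'.2 :=
    ⟨((z.1 + z.2 + (z'.1 - z'.2)) / 2, (z.1 + z.2 - (z'.1 - z'.2)) / 2),
      by simp only; omega, by simp only; omega⟩
  have hy : x ∈ closedSquare y := by
    have hs' : (y.1 + y.2 : ℝ) = z.1 + z.2 := by exact_mod_cast hs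
    have hd' : (y.1 - y.2 : ℝ) = z'.1 - z'.2 := by exact_mod_cast hd
    exact ⟨hs' ▸ hx.1, hd' ▸ hx'.2⟩
  by_cases h : wind z p = wind y p
  · exact mem_trace_of_same_diff hG (by omega) p (h ▸ hw) hd hy hx'
  · exact mem_trace_of_same_sum hG hz p h hs.symm hx hy

/-- A square around which a closed walk winds does not lie in its exterior. -/
lemma wind_eq_zero_of_subset_exterior (hG : ∀ a b, G.Adj a b → IsDiagonalStep a b)
    (hz : (z.1 + z.2) % 2 = 1) (p : G.Walk v v) (h : openSquare z ⊆ cycleExterior p) :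
    wind z p = 0 := by
  by_contra hw
  obtain ⟨hx, hunb⟩ := h (show toPlane z ∈ openSquare z by simp [openSquare, toPlane])
  set A : Set Pt := {y | (y.1 + y.2) % 2 = 1 ∧ wind y p ≠ 0}
  set B : Set Pt := {y | (y.1 + y.2) % 2 = 1 ∧ wind y p = 0}
  set D := connectedComponentIn (trace p)ᶜ (toPlane z)
  have hcover : ∀ x, x ∈ (⋃ y ∈ A, closedSquare y) ∪ ⋃ y ∈ B, closedSquare y := by
    intro x
    obtain ⟨y, hy, hxy⟩ := exists_mem_closedSquare x
    by_cases hwy : wind y p = 0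
    · exact Or.inr (Set.mem_biUnion (show y ∈ B from ⟨hy, hwy⟩) hxy)
    · exact Or.inl (Set.mem_biUnion (show y ∈ A from ⟨hy, hwy⟩) hxy)
  have hdisj : ¬ (D ∩ ⋃ y ∈ B, closedSquare y).Nonempty := by
    intro hB
    obtain ⟨x, hxD, hxA, hxB⟩ := isPreconnected_closed_iff.1 isPreconnected_connectedComponentIn
      _ _ (isClosed_biUnion_closedSquare A) (isClosed_biUnion_closedSquare B)
      (fun x _ => hcover x)
      ⟨toPlane z, mem_connectedComponentIn hx,
        Set.mem_biUnion (show z ∈ A from ⟨hz, hw⟩) (toPlane_mem_closedSquare z)⟩ hB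
    obtain ⟨a, ha, hxa⟩ := Set.mem_iUnion₂.1 hxA
    obtain ⟨b, hb, hxb⟩ := Set.mem_iUnion₂.1 hxB
    exact connectedComponentIn_subset _ _ hxD
      (mem_trace_of_wind_ne hG ha.1 hb.1 p (by rw [hb.2]; exact ha.2) hxa hxb)
  refine hunb ?_
  obtain ⟨N, hN⟩ := exists_bound_wind hG p
  refine (Metric.isBounded_Icc ((-(N + 1), -(N + 1)) : ℝ × ℝ) (N + 1, N + 1)).subset ?_
  intro x hxD
  obtain ⟨y, hy, hxy₁, hxy₂⟩ := Set.mem_iUnion₂.1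
    ((hcover x).resolve_right fun hxB => hdisj ⟨x, hxD, hxB⟩)
  obtain ⟨h₁, h₂⟩ := hN y hy.1 hy.2
  rw [abs_le] at h₁ h₂ hxy₁ hxy₂
  rify at h₁ h₂
  simp only [Set.mem_Icc, Prod.le_def]
  refine ⟨⟨?_, ?_⟩, ?_, ?_⟩ <;> linarith

end exterior

section squares

variable {K : Set Pt} {z v : Pt}

lemma isDiagonalStep_of_adj (hK : ∀ z ∈ K, (z.1 + z.2) % 2 = 1) (a b : Pt)
    (h : (squareGraph K).Adj a b) : IsDiagonalStep a b := by
  obtain ⟨h, -⟩ := (fromEdgeSet_adj _).1 h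
  obtain ⟨z, hz, ⟨c, d⟩, hcd, he⟩ := Set.mem_iUnion₂.1 h
  have hodd := hK z hz
  simp only [arrows, Set.mem_insert_iff, Set.mem_singleton_iff, Prod.ext_iff] at hcd
  rw [Sym2.eq_iff] at he
  simp only [Prod.ext_iff] at he
  refine ⟨?_, ?_, ?_⟩ <;> omega

lemma adj_of_mem_arrows (hz : z ∈ K) {a b : Pt} (h : (a, b) ∈ arrows z) :
    (squareGraph K).Adj a b := by
  refine (fromEdgeSet_adj _).2 ⟨Set.mem_biUnion hz ⟨(a, b), h, rfl⟩, ?_⟩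
  rintro rfl
  simp only [arrows, Set.mem_insert_iff, Set.mem_singleton_iff, Prod.ext_iff] at h
  omega

/-- The way around a square that avoids a given edge of it. -/
lemma exists_detour (hz : z ∈ K) {a b : Pt} (h : (a, b) ∈ arrows z) :
    ∃ q : (squareGraph K).Walk b a, s(a, b) ∉ q.edges ∧ wind z q + crossing z a b = 1 := by
  have h₁ := adj_of_mem_arrows hz (a := (z.1 - 1, z.2)) (b := (z.1, z.2 + 1)) (by simp [arrows])
  have h₂ := adj_of_mem_arrows hz (a := (z.1, z.2 + 1)) (b := (z.1 + 1, z.2)) (by simp [arrows])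
  have h₃ := adj_of_mem_arrows hz (a := (z.1 + 1, z.2)) (b := (z.1, z.2 - 1)) (by simp [arrows])
  have h₄ := adj_of_mem_arrows hz (a := (z.1, z.2 - 1)) (b := (z.1 - 1, z.2)) (by simp [arrows])
  have c₁ : crossing z (z.1 - 1, z.2) (z.1, z.2 + 1) = 0 := if_neg (by simp only; omega)
  have c₂ : crossing z (z.1, z.2 + 1) (z.1 + 1, z.2) = 1 := if_pos (by simp only; omega)
  have c₃ : crossing z (z.1 + 1, z.2) (z.1, z.2 - 1) = 0 := if_neg (by simp only; omega)
  have c₄ : crossing z (z.1, z.2 - 1) (z.1 - 1, z.2) = 0 := if_neg (by simp only; omega)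
  have key : ∀ a b c d : Pt, ∀ (hbc : (squareGraph K).Adj b c) (hcd : (squareGraph K).Adj c d)
      (hda : (squareGraph K).Adj d a), a ≠ c → b ≠ d →
      crossing z b c + crossing z c d + crossing z d a + crossing z a b = 1 → a ≠ b →
      ∃ q : (squareGraph K).Walk b a, s(a, b) ∉ q.edges ∧ wind z q + crossing z a b = 1 := by
    intro a b c d hbc hcd hda hac hbd hsum hab
    refine ⟨Walk.cons hbc (Walk.cons hcd (Walk.cons hda Walk.nil)), ?_, ?_⟩
    · simp only [Walk.edges_cons, Walk.edges_nil, List.mem_cons, List.not_mem_nil, or_false,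
        Sym2.eq_iff]
      have := hbc.ne
      grind
    · rw [wind_cons, wind_cons, wind_cons, wind_nil]
      linear_combination hsum
  simp only [arrows, Set.mem_insert_iff, Set.mem_singleton_iff, Prod.mk.injEq] at h
  rcases h with ⟨rfl, rfl⟩ | ⟨rfl, rfl⟩ | ⟨rfl, rfl⟩ | ⟨rfl, rfl⟩
  · exact key _ _ _ _ h₂ h₃ h₄ (by simp; omega) (by simp; omega)
      (by rw [c₁, c₂, c₃, c₄]; rfl) h₁.ne
  · exact key _ _ _ _ h₃ h₄ h₁ (by simp; omega) (by simp; omega)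
      (by rw [c₁, c₂, c₃, c₄]; rfl) h₂.ne
  · exact key _ _ _ _ h₄ h₁ h₂ (by simp; omega) (by simp; omega)
      (by rw [c₁, c₂, c₃, c₄]; rfl) h₃.ne
  · exact key _ _ _ _ h₁ h₂ h₃ (by simp; omega) (by simp; omega)
      (by rw [c₁, c₂, c₃, c₄]; rfl) h₄.ne

lemma exists_append_of_mem_darts {G : SimpleGraph Pt} {u w : Pt} (p : G.Walk u w) {d : G.Dart}
    (hd : d ∈ p.darts) :
    ∃ (q : G.Walk u d.fst) (r : G.Walk d.snd w), p = q.append (Walk.cons d.adj r) := by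
  induction p with
  | nil => simp at hd
  | cons h p ih =>
    rw [Walk.darts_cons, List.mem_cons] at hd
    rcases hd with rfl | hd
    · exact ⟨Walk.nil, p, rfl⟩
    · obtain ⟨q, r, rfl⟩ := ih hd
      exact ⟨Walk.cons h q, r, rfl⟩

/-- If a cycle runs along an edge of the outermost boundary, then it encloses every square of the
union that has this edge. -/
lemma wind_eq_one_of_mem_outermostBoundary (hK : ∀ z ∈ K, (z.1 + z.2) % 2 = 1)
    {C : (squareGraph K).Walk v v} (hC : C.IsCycle) {d : (squareGraph K).Dart}
    (hd : d ∈ C.darts) (hb : d.edge ∈ outermostBoundary K) (hz : z ∈ K)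
    (h : (d.fst, d.snd) ∈ arrows z ∨ (d.snd, d.fst) ∈ arrows z) : wind z C = 1 := by
  have hG := isDiagonalStep_of_adj hK
  obtain ⟨t, ht, hw⟩ : ∃ t : (squareGraph K).Walk d.fst d.snd, s(d.fst, d.snd) ∉ t.edges ∧
      wind z t + crossing z d.fst d.snd = 1 := by
    rcases h with h | h
    · obtain ⟨q, hq, hw⟩ := exists_detour hz h
      exact ⟨q.reverse, by simpa using hq, by simpa using hw⟩
    · obtain ⟨q, hq, hw⟩ := exists_detour hz h
      exact ⟨q, by rwa [Sym2.eq_swap], by rwa [crossing_comm]⟩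
  obtain ⟨q, r, hqr⟩ := exists_append_of_mem_darts C hd
  refine eq_one_of_ne_zero_zmod_two fun h0 => ?_
  have hnodup := hC.edges_nodup
  rw [hqr, Walk.edges_append, Walk.edges_cons, List.nodup_middle, List.nodup_cons,
    List.mem_append] at hnodup
  have hnew : wind z (q.append (t.append r)) ≠ 0 := by
    have h2 : wind z (q.append (t.append r)) = 1 := by
      rw [hqr] at h0
      simp only [wind_append, wind_cons] at h0 ⊢
      linear_combination h0 + hw - add_self_zmod_two (crossing z d.fst d.snd)
    rw [h2]
    exact one_ne_zero
  obtain ⟨x, C', hC', hsub, hw'⟩ := exists_isCycle_of_wind_ne_zero _ hnew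
  rcases hb.2 x C' hC' with he | he
  · have := hsub he
    rw [Walk.edges_append, Walk.edges_append, List.mem_append, List.mem_append] at this
    have he' : d.edge = s(d.fst, d.snd) := rfl
    rw [he'] at this
    tauto
  · refine hw' (wind_eq_zero_of_subset_exterior hG (hK z hz) C' (he z ?_))
    rcases h with h | h
    · exact ⟨_, h, rfl⟩
    · exact ⟨_, h, Sym2.eq_swap⟩

/-- The square to the right of a diagonal step. -/
def rightSquare (a b : Pt) : Pt :=
  ((a.1 + b.1 + (b.2 - a.2)) / 2, (a.2 + b.2 - (b.1 - a.1)) / 2)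

lemma mem_arrows_iff {a b : Pt} (h : IsDiagonalStep a b) :
    (a, b) ∈ arrows z ↔ z = rightSquare a b := by
  obtain ⟨a₁, a₂⟩ := a
  obtain ⟨b₁, b₂⟩ := b
  obtain ⟨h₁, h₂, h₃⟩ := h
  simp only [arrows, Set.mem_insert_iff, Set.mem_singleton_iff, Prod.ext_iff, rightSquare] at *
  rcases h₁ with rfl | rfl <;> rcases h₂ with rfl | rfl <;> omega

lemma IsDiagonalStep.symm {a b : Pt} (h : IsDiagonalStep a b) : IsDiagonalStep b a := by
  unfold IsDiagonalStep at *
  omega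

lemma rightSquare_odd {a b : Pt} (h : IsDiagonalStep a b) :
    ((rightSquare a b).1 + (rightSquare a b).2) % 2 = 1 := by
  unfold IsDiagonalStep at h
  simp only [rightSquare]
  omega

lemma wind_rightSquare_add {G : SimpleGraph Pt} (hG : ∀ a b, G.Adj a b → IsDiagonalStep a b)
    {C : G.Walk v v} (hC : C.IsCycle) {a b : Pt} (hab : s(a, b) ∈ C.edges) :
    wind (rightSquare a b) C + wind (rightSquare b a) C = 1 := by
  have h := hG _ _ (C.adj_of_mem_edges hab)
  rw [wind_add_wind_of_arrows hG (rightSquare_odd h) ((mem_arrows_iff h).2 rfl)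
    ((mem_arrows_iff h.symm).2 rfl), List.count_eq_one_of_mem hC.edges_nodup hab, Nat.cast_one]

lemma dart_eq_of_snd_eq {G : SimpleGraph Pt} {C : G.Walk v v} (hC : C.IsCycle) {d e : G.Dart}
    (hd : d ∈ C.darts) (he : e ∈ C.darts) (h : d.snd = e.snd) : d = e := by
  refine List.inj_on_of_nodup_map (f := fun d : G.Dart => d.snd) ?_ hd he h
  rw [Walk.map_snd_darts]
  exact hC.support_nodup

lemma dart_eq_of_fst_eq {G : SimpleGraph Pt} {C : G.Walk v v} (hC : C.IsCycle) {d e : G.Dart}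
    (hd : d ∈ C.darts) (he : e ∈ C.darts) (h : d.fst = e.fst) : d = e := by
  have hsymm := dart_eq_of_snd_eq hC.reverse (d := d.symm) (e := e.symm)
    (by simpa using hd) (by simpa using he) h
  simpa using congrArg Dart.symm hsymm

/-- When two consecutive diagonal steps go straight on, there is a step perpendicular to them. -/
lemma exists_perpendicular_step {a w b : Pt} (h : IsDiagonalStep a w) (h' : IsDiagonalStep w b)
    (hne : a ≠ b) (hR : rightSquare a w ≠ rightSquare w b)
    (hL : rightSquare w a ≠ rightSquare b w) :
    ∃ c, IsDiagonalStep w c ∧ rightSquare w c = rightSquare a w ∧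
      rightSquare c w = rightSquare w b ∧ c ≠ b ∧ c ≠ a := by
  obtain ⟨a₁, a₂⟩ := a
  obtain ⟨w₁, w₂⟩ := w
  obtain ⟨b₁, b₂⟩ := b
  obtain ⟨h₁, h₂, h₃⟩ := h
  obtain ⟨h₁', h₂', h₃'⟩ := h'
  refine ⟨(w₁ + (w₂ - a₂), w₂ - (w₁ - a₁)), ?_⟩
  simp only [IsDiagonalStep, rightSquare, Prod.ext_iff, ne_eq] at *
  rcases h₁ with rfl | rfl <;> rcases h₂ with rfl | rfl <;> rcases h₁' with rfl | rfl <;>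
    rcases h₂' with rfl | rfl <;> first
      | (exfalso; omega)
      | (refine ⟨⟨?_, ?_, ?_⟩, ⟨?_, ?_⟩, ⟨?_, ?_⟩, ?_, ?_⟩ <;> clear hne hR hL <;> omega)

/-- The region to the right of a cycle is the same along consecutive darts. -/
lemma wind_rightSquare_eq {G : SimpleGraph Pt} (hG : ∀ a b, G.Adj a b → IsDiagonalStep a b)
    {C : G.Walk v v} (hC : C.IsCycle) {d e : G.Dart}
    (hd : d ∈ C.darts) (he : e ∈ C.darts) (hde : d.snd = e.fst) (hne : d.fst ≠ e.snd) :
    wind (rightSquare d.fst d.snd) C = wind (rightSquare e.fst e.snd) C := by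
  have hd' := wind_rightSquare_add hG hC (List.mem_map.2 ⟨d, hd, rfl⟩ : s(d.fst, d.snd) ∈ C.edges)
  have he' := wind_rightSquare_add hG hC (List.mem_map.2 ⟨e, he, rfl⟩ : s(e.fst, e.snd) ∈ C.edges)
  have hds := hG _ _ d.adj
  have hes := hG _ _ e.adj
  by_cases hR : rightSquare d.fst d.snd = rightSquare e.fst e.snd
  · rw [hR]
  by_cases hL : rightSquare d.snd d.fst = rightSquare e.snd e.fst
  · rw [hL] at hd'
    exact add_right_cancel (hd'.trans he'.symm)
  obtain ⟨c, hwc, h₁, h₂, hce, hcd⟩ :=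
    exists_perpendicular_step (w := d.snd) hds (hde ▸ hes) hne (hde ▸ hR) (hde ▸ hL)
  have hnot : s(d.snd, c) ∉ C.edges := by
    intro hmem
    obtain ⟨f, hf, hfe⟩ := List.mem_map.1 hmem
    rcases SimpleGraph.dart_edge_eq_mk'_iff'.1 hfe with ⟨hf₁, hf₂⟩ | ⟨hf₁, hf₂⟩
    · have := dart_eq_of_fst_eq hC hf he (hf₁.trans hde)
      exact hce (by rw [← hf₂, this])
    · have := dart_eq_of_snd_eq hC hf hd hf₂
      exact hcd (by rw [← hf₁, this])
  have h := wind_add_wind_of_arrows hG (rightSquare_odd hwc) ((mem_arrows_iff hwc).2 rfl)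
    ((mem_arrows_iff hwc.symm).2 rfl) C
  rw [List.count_eq_zero.2 hnot, Nat.cast_zero, CharTwo.add_eq_zero] at h
  rw [← h₁, ← hde, ← h₂, h]

lemma isChain_eq_of_forall {α β : Type*} (f : α → β) {L : List α}
    (h : L.IsChain fun a b => f a = f b) {a b : α} (ha : a ∈ L) (hb : b ∈ L) : f a = f b := by
  induction L with
  | nil => simp at ha
  | cons x L ih =>
    have hx : ∀ y ∈ L, f x = f y := by
      have : (x :: L).Pairwise fun a b => f a = f b :=
        haveI : IsTrans α fun a b => f a = f b := ⟨fun _ _ _ => Eq.trans⟩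
        List.isChain_iff_pairwise.1 h
      exact (List.pairwise_cons.1 this).1
    rcases List.mem_cons.1 ha with rfl | ha' <;> rcases List.mem_cons.1 hb with rfl | hb'
    · rfl
    · exact hx _ hb'
    · exact (hx _ ha').symm
    · exact (hx _ ha').symm.trans (hx _ hb')

lemma wind_rightSquare_eq_of_mem {G : SimpleGraph Pt}
    (hG : ∀ a b, G.Adj a b → IsDiagonalStep a b) {C : G.Walk v v} (hC : C.IsCycle)
    {d e : G.Dart} (hd : d ∈ C.darts) (he : e ∈ C.darts) :
    wind (rightSquare d.fst d.snd) C = wind (rightSquare e.fst e.snd) C := by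
  refine isChain_eq_of_forall (fun d : G.Dart => wind (rightSquare d.fst d.snd) C) ?_ hd he
  rw [List.isChain_iff_forall_rel_of_append_cons_cons]
  rintro a b l₁ l₂ hl
  have ha : a ∈ C.darts := by simp [hl]
  have hb : b ∈ C.darts := by simp [hl]
  have hadj : a.snd = b.fst :=
    List.isChain_iff_forall_rel_of_append_cons_cons.1 C.isChain_dartAdj_darts hl
  refine wind_rightSquare_eq hG hC ha hb hadj fun hab => ?_
  have hnodup := hC.edges_nodup
  have hedge : a.edge = b.edge := by
    change s(a.fst, a.snd) = s(b.fst, b.snd)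
    rw [hab, hadj, Sym2.eq_swap]
  rw [Walk.edges, hl] at hnodup
  simp [hedge, List.nodup_append] at hnodup

lemma isOrientedPath_darts {G : SimpleGraph Pt} {E : Set (Pt × Pt)} {C : G.Walk v v}
    (hC : C.IsCycle) (h : ∀ d ∈ C.darts, d.toProd ∈ E) :
    IsOrientedPath E (C.darts.map fun d => d.toProd) v v where
  mem := by simpa using fun a b => h a b
  nodup := (List.Nodup.of_map _ hC.edges_nodup).map fun _ _ => Dart.ext _ _
  consistent := by
    rw [List.isChain_map]
    exact C.isChain_dartAdj_darts
  start := by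
    cases C with
    | nil => exact absurd hC (by simp)
    | cons h p => simp
  finish := by
    have hne : ¬ C.Nil := hC.not_nil
    refine ⟨(C.lastDart hne).toProd, ?_, rfl⟩
    rw [List.getLast?_map, List.getLast?_eq_some_getLast (Walk.darts_eq_nil.not.2 hne),
      Walk.getLast_darts_eq_lastDart]
    rfl

/-- A cycle contained in the outermost boundary of a union of squares with odd centers is an
oriented dual cycle. -/
theorem isOrientedDualCycle_of_outermostBoundary (hK : ∀ z ∈ K, (z.1 + z.2) % 2 = 1)
    {C : (squareGraph K).Walk v v} (hC : C.IsCycle)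
    (hb : ∀ e ∈ C.edges, e ∈ outermostBoundary K) : IsOrientedDualCycle K C := by
  have hG := isDiagonalStep_of_adj hK
  have hone : ∀ d ∈ C.darts, ∀ z ∈ K, ((d.fst, d.snd) ∈ arrows z ∨ (d.snd, d.fst) ∈ arrows z) →
      wind z C = 1 := fun d hd z hz h =>
    wind_eq_one_of_mem_outermostBoundary hK hC hd (hb _ (List.mem_map.2 ⟨d, hd, rfl⟩)) hz h
  have hmem : ∀ a b : Pt, s(a, b) ∈ C.edges → wind (rightSquare a b) C = 1 →
      (a, b) ∈ orientedDualEdges K := by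
    intro a b hab hw
    have hadj := C.adj_of_mem_edges hab
    have hstep := hG _ _ hadj
    have hsum := wind_rightSquare_add hG hC hab
    have hL : wind (rightSquare b a) C ≠ 1 := by
      intro hL
      rw [hw, hL] at hsum
      exact absurd hsum (by decide)
    have hone' : ∀ z ∈ K, ((a, b) ∈ arrows z ∨ (b, a) ∈ arrows z) → wind z C = 1 := by
      intro z hz h
      obtain ⟨d, hd, hde⟩ := List.mem_map.1 hab
      rcases SimpleGraph.dart_edge_eq_mk'_iff'.1 hde with ⟨rfl, rfl⟩ | ⟨rfl, rfl⟩
      · exact hone d hd z hz h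
      · exact hone d hd z hz h.symm
    have hnot : ∀ z ∈ K, (b, a) ∉ arrows z := fun z hz h =>
      hL ((mem_arrows_iff hstep.symm).1 h ▸ hone' z hz (Or.inr h))
    refine ⟨?_, hnot⟩
    obtain ⟨hE, -⟩ := (fromEdgeSet_adj _).1 hadj
    obtain ⟨z, hz, ⟨c, d⟩, hcd, he⟩ := Set.mem_iUnion₂.1 hE
    rcases Sym2.eq_iff.1 he with ⟨h₁, h₂⟩ | ⟨h₁, h₂⟩
    · simp only at h₁ h₂
      subst h₁ h₂
      exact ⟨z, hz, hcd⟩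
    · simp only at h₁ h₂
      subst h₁ h₂
      exact absurd hcd (hnot z hz)
  by_cases hpos : ∀ d ∈ C.darts, wind (rightSquare d.fst d.snd) C = 1
  · exact ⟨C, Or.inl rfl, isOrientedPath_darts hC fun d hd =>
      hmem _ _ (List.mem_map.2 ⟨d, hd, rfl⟩) (hpos d hd)⟩
  · push Not at hpos
    obtain ⟨e, he, hew⟩ := hpos
    refine ⟨C.reverse, Or.inr rfl, isOrientedPath_darts hC.reverse fun d hd => ?_⟩
    have hd' : d.symm ∈ C.darts := by simpa using hd
    have hedge : s(d.snd, d.fst) ∈ C.edges := List.mem_map.2 ⟨d.symm, hd', rfl⟩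
    refine hmem _ _ (by rwa [Sym2.eq_swap]) ?_
    have hsum := wind_rightSquare_add hG hC hedge
    have heq : wind (rightSquare d.snd d.fst) C ≠ 1 :=
      (wind_rightSquare_eq_of_mem hG hC hd' he).trans_ne hew
    generalize wind (rightSquare d.snd d.fst) C = x at *
    generalize wind (rightSquare d.fst d.snd) C = y at *
    revert x y
    decide

end squares

lemma openCluster_odd {m n : ℕ} {ω : Set (Pt × Pt)} (hω : ω ⊆ modelEdges m n) :
    ∀ z ∈ openCluster m n ω, (z.1 + z.2) % 2 = 1 := by
  rintro z ⟨-, ⟨h₁, h₂⟩ | ⟨-, j, L, -, -, hL⟩⟩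
  · rw [h₁, zero_add]
    exact Int.odd_iff.1 h₂
  · obtain ⟨e, he, rfl⟩ := hL.finish
    obtain ⟨-, -, hodd, h₁, h₂⟩ := hω (hL.mem e (List.mem_of_getLast? he))
    rw [Int.odd_iff] at hodd
    omega

end OrientedPercolation

theorem theorem6 (m n : ℕ) (hm : 1 ≤ m) (hn : 1 ≤ n)
    (ω : Set (OrientedPercolation.Pt × OrientedPercolation.Pt))
    (hω : ω ⊆ OrientedPercolation.modelEdges m n)
    (v : OrientedPercolation.Pt)
    (C : (OrientedPercolation.squareGraph (OrientedPercolation.openCluster m n ω)).Walk v v)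
    (hC : C.IsCycle)
    (hCb : ∀ e ∈ C.edges,
      e ∈ OrientedPercolation.outermostBoundary (OrientedPercolation.openCluster m n ω)) :
    OrientedPercolation.IsOrientedDualCycle (OrientedPercolation.openCluster m n ω) C :=
  OrientedPercolation.isOrientedDualCycle_of_outermostBoundary
    (OrientedPercolation.openCluster_odd hω) hC hCb
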